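/- Let $$P=\langle x,y \mid x^{-1}y^2xy^2,\ y^{-1}x^2yx^2\rangle$$ be Promislow's group. There exists a finitely generated, residually finite, torsion-free group $G$ that persistently contains $P$: every finite-index subgroup of $G$ contains a subgroup isomorphic to $P$. Moreover, for this $G$, no finite-index subgroup of $G$ has the unique product property, and $G$ is not virtually diffuse, i.e. no finite-index subgroup of $G$ is diffuse. Here a group $\Gamma$ has the unique product property if for all nonempty finite $A,B\subseteq \Gamma$ there is $(a,b)\in A\times B$ such that $ab\ne a'b'$ for all $(a',b')\in A\times B$ with $(a',b')\neq(a,b)$. A group $\Gamma$ is diffuse if every nonempty finite $A\subseteq\Gamma$ contains an element $a$ such that for every $g\in\Gamma\setminus\{1\}$ at least one of $ga$, $g^{-1}a$ is not in $A$. -/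

import Mathlib

/-- Promislow's group `⟨x, y ∣ x⁻¹ y² x y², y⁻¹ x² y x²⟩`, the free generators `x`, `y` being
`FreeGroup.of 0`, `FreeGroup.of 1`. -/
abbrev PromislowGroup : Type :=
  PresentedGroup
    ({(FreeGroup.of 0)⁻¹ * (FreeGroup.of 1) ^ 2 * FreeGroup.of 0 * (FreeGroup.of 1) ^ 2,
      (FreeGroup.of 1)⁻¹ * (FreeGroup.of 0) ^ 2 * FreeGroup.of 1 * (FreeGroup.of 0) ^ 2} :
      Set (FreeGroup (Fin 2)))

/-- `G` persistently contains `P`: every finite index subgroup of `G` contains a subgroup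
isomorphic to `P`. -/
def PersistentlyContains (G P : Type*) [Group G] [Group P] : Prop :=
  ∀ C : Subgroup G, C.FiniteIndex → ∃ H : Subgroup G, H ≤ C ∧ Nonempty (H ≃* P)

/-- `G` is torsion-free: only the identity has finite order. (Mathlib's `IsMulTorsionFree` asks for
unique roots, which is stronger for non-commutative groups.) -/
def GroupTorsionFree (G : Type*) [Group G] : Prop :=
  ∀ g : G, IsOfFinOrder g → g = 1

/-- `G` is diffuse: every nonempty finite subset `A` has an extremal element, that is an `a ∈ A`
such that for every `g ≠ 1` not both of `g * a`, `g⁻¹ * a` lie in `A`. -/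
def Diffuse (G : Type*) [Group G] : Prop :=
  ∀ A : Finset G, A.Nonempty → ∃ a ∈ A, ∀ g : G, g ≠ 1 → g * a ∉ A ∨ g⁻¹ * a ∉ A

/-- `G` is virtually diffuse: some finite index subgroup of `G` is diffuse. -/
def VirtuallyDiffuse (G : Type*) [Group G] : Prop :=
  ∃ C : Subgroup G, C.FiniteIndex ∧ Diffuse C

/-!
Promislow's group `P` is the Hantzsche–Wendt crystallographic group: an extension of the Klein four
group by the lattice `⟨x², y², (xy)²⟩ ≅ ℤ³`, acting on the three coordinate axes of `ℝ³` by infinite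
dihedral groups. The group `G` is an infinite-dimensional analogue of it, with a lamplighter group
as holonomy.

Let `X` be the group of periodic sequences `c : ℤ → 𝔽₄`, let `ω ∈ 𝔽₄` be a primitive cube root of
unity, and take one copy of `ℤ` (a line) for each `c ∈ X`. Consider the permutations of the union of
the lines that move the line of `c` to the line of the shifted sequence `shift e c` by
`r ↦ (-1)^(μ c) r + τ c`, where `μ : X → 𝔽₂` is a functional and `τ c ≡ μ (ω c)` modulo `2`. They
form a group, `twistedGroup`.

* It is torsion-free (`eq_one_of_mem_twistedGroup`). An element of finite order has `e = 0`. If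
  `μ ≠ 0`, there is some `c` with `μ c = 0` and `μ (ω c) = 1`, because `1 + ω + ω² = 0`, and on its
  line the element is a translation by an odd number. If `μ = 0` it is a translation on each line.
* Its subgroups are residually finite (`residuallyFinite_of_le_twistedGroup`): the sets
  `{c} × (r + mℤ)` have finite orbits, as `c` is periodic, and their stabilizers separate elements.

`G` (`persistentGroup`) is generated by the shift `t` and by two elements `a`, `b` with functionals
`μ₀` and `μ₀ ∘ ω`, where `μ₀` reads off a bit of `c 0`, and with all translation parts in `{0, 1}`.
A finite index subgroup contains the commutators `[a, tᵏ]` and `[b, tᵏ]` for some `k ≠ 0`. They fix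
all lines and have functionals `μ` and `μ ∘ ω` for a certain `μ ≠ 0`. On a line where both signs are
trivial, `a` agrees with `tᵏ a t⁻ᵏ` and `b` with `tᵏ b t⁻ᵏ`, so both commutators are trivial there;
on every other line at least one of them is a reflection. This gives the relations of `P`
(`promislow_relations`). Three lines on which the pairs of signs are the three nontrivial ones
recover the coordinate axes, whence injectivity (`promislow_lift_injective`, which rests on the
criterion `PromislowGroup.eq_one_of_map_eq_one`).

Promislow's fourteen-element set shows that `P` is not a unique product group. The unique product
property passes to subgroups and follows from diffuseness, so no finite index subgroup of `G` has
it or is diffuse.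
-/

/-! ### Promislow's group -/

namespace PromislowGroup

/-- The first standard generator of Promislow's group. -/
def genX : PromislowGroup := PresentedGroup.of 0

/-- The second standard generator of Promislow's group. -/
def genY : PromislowGroup := PresentedGroup.of 1

theorem relation_genX : genX⁻¹ * genY ^ 2 * genX * genY ^ 2 = 1 :=
  PresentedGroup.one_of_mem (rels := {(FreeGroup.of 0)⁻¹ * (FreeGroup.of 1) ^ 2 * FreeGroup.of 0 *
    (FreeGroup.of 1) ^ 2, (FreeGroup.of 1)⁻¹ * (FreeGroup.of 0) ^ 2 * FreeGroup.of 1 *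
    (FreeGroup.of 0) ^ 2}) (Set.mem_insert _ _)

theorem relation_genY : genY⁻¹ * genX ^ 2 * genY * genX ^ 2 = 1 :=
  PresentedGroup.one_of_mem (rels := {(FreeGroup.of 0)⁻¹ * (FreeGroup.of 1) ^ 2 * FreeGroup.of 0 *
    (FreeGroup.of 1) ^ 2, (FreeGroup.of 1)⁻¹ * (FreeGroup.of 0) ^ 2 * FreeGroup.of 1 *
    (FreeGroup.of 0) ^ 2}) (Set.mem_insert_of_mem _ rfl)

/-- The homomorphism out of Promislow's group given by two elements satisfying the relations. -/
def lift {Γ : Type*} [Group Γ] (u v : Γ) (h₁ : u⁻¹ * v ^ 2 * u * v ^ 2 = 1)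
    (h₂ : v⁻¹ * u ^ 2 * v * u ^ 2 = 1) : PromislowGroup →* Γ :=
  PresentedGroup.toGroup (f := ![u, v]) (by rintro _ (rfl | rfl) <;> simpa)

section Lift
variable {Γ : Type*} [Group Γ] {u v : Γ} (h₁ : u⁻¹ * v ^ 2 * u * v ^ 2 = 1)
  (h₂ : v⁻¹ * u ^ 2 * v * u ^ 2 = 1)

@[simp] theorem lift_genX : lift u v h₁ h₂ genX = u := by simp [lift, genX]

@[simp] theorem lift_genY : lift u v h₁ h₂ genY = v := by simp [lift, genY]

end Lift

theorem closure_gens : Subgroup.closure {genX, genY} = ⊤ := by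
  rw [← PresentedGroup.closure_range_of]
  congr 1
  ext p
  simp [Fin.exists_fin_two, genX, genY, eq_comm]

theorem range_le {Γ : Type*} [Group Γ] (f : PromislowGroup →* Γ) {C : Subgroup Γ}
    (hx : f genX ∈ C) (hy : f genY ∈ C) : f.range ≤ C := by
  rw [MonoidHom.range_eq_map, ← closure_gens, MonoidHom.map_closure, Subgroup.closure_le]
  rintro _ ⟨_, rfl | rfl, rfl⟩ <;> assumption

theorem genX_semiconj_sq : SemiconjBy genX (genY ^ 2) (genY ^ 2)⁻¹ := by
  have h : genX⁻¹ * genY ^ 2 * genX = (genY ^ 2)⁻¹ := eq_inv_of_mul_eq_one_left relation_genX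
  have h' : SemiconjBy genX (genY ^ 2)⁻¹ (genY ^ 2) := by
    rw [SemiconjBy, ← h]; group
  simpa using h'.inv_right

theorem genY_semiconj_sq : SemiconjBy genY (genX ^ 2) (genX ^ 2)⁻¹ := by
  have h : genY⁻¹ * genX ^ 2 * genY = (genX ^ 2)⁻¹ := eq_inv_of_mul_eq_one_left relation_genY
  have h' : SemiconjBy genY (genX ^ 2)⁻¹ (genX ^ 2) := by
    rw [SemiconjBy, ← h]; group
  simpa using h'.inv_right

theorem commute_sq : Commute (genX ^ 2) (genY ^ 2) := by
  have := genX_semiconj_sq.inv_right.mul_left genX_semiconj_sq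
  rwa [inv_inv, ← sq] at this

theorem genY_mul_genX_sq : (genY * genX) ^ 2 = ((genX * genY) ^ 2)⁻¹ := by
  rw [eq_inv_iff_mul_eq_one]
  calc (genY * genX) ^ 2 * (genX * genY) ^ 2
      = genY * genX * (genY * genX ^ 2) * genY * genX * genY := by simp only [sq, mul_assoc]
    _ = genY * genX * (genX ^ 2)⁻¹ * (genY ^ 2) * genX * genY := by
      rw [genY_semiconj_sq.eq]; simp only [sq, mul_assoc]
    _ = genY * (genX ^ 2)⁻¹ * (genX * genY ^ 2) * genX * genY := by group
    _ = genY * (genX ^ 2)⁻¹ * ((genY ^ 2)⁻¹ * genX ^ 2) * genY := by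
      rw [genX_semiconj_sq.eq]; simp only [sq, mul_assoc]
    _ = 1 := by rw [← commute_sq.inv_right.eq]; group

theorem genX_semiconj_mul_sq :
    SemiconjBy genX ((genX * genY) ^ 2) ((genX * genY) ^ 2)⁻¹ := by
  have h : SemiconjBy genX ((genY * genX) ^ 2) ((genX * genY) ^ 2) := by
    simp only [SemiconjBy, sq, mul_assoc]
  rw [genY_mul_genX_sq] at h
  simpa using h.inv_right

theorem genY_semiconj_mul_sq :
    SemiconjBy genY ((genX * genY) ^ 2) ((genX * genY) ^ 2)⁻¹ := by
  rw [← genY_mul_genX_sq]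
  simp only [SemiconjBy, sq, mul_assoc]

theorem commute_genX_sq_mul_sq : Commute (genX ^ 2) ((genX * genY) ^ 2) := by
  have := genX_semiconj_mul_sq.inv_right.mul_left genX_semiconj_mul_sq
  rwa [inv_inv, ← sq] at this

theorem commute_genY_sq_mul_sq : Commute (genY ^ 2) ((genX * genY) ^ 2) := by
  have := genY_semiconj_mul_sq.inv_right.mul_left genY_semiconj_mul_sq
  rwa [inv_inv, ← sq] at this

/-- The element `x^(2a) y^(2b) (xy)^(2c)` of the translation lattice of Promislow's group. -/
def latticeElt (a b c : ℤ) : PromislowGroup :=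
  (genX ^ 2) ^ a * (genY ^ 2) ^ b * ((genX * genY) ^ 2) ^ c

theorem latticeElt_mul (a b c a' b' c' : ℤ) :
    latticeElt a b c * latticeElt a' b' c' = latticeElt (a + a') (b + b') (c + c') := by
  have h₁ := (commute_genX_sq_mul_sq.symm.zpow_zpow c a').eq
  have h₂ := (commute_genY_sq_mul_sq.symm.zpow_zpow c b').eq
  have h₃ := (commute_sq.symm.zpow_zpow b a').eq
  simp only [latticeElt, zpow_add]
  generalize (genX ^ 2) ^ a = A at *
  generalize (genX ^ 2) ^ a' = A' at *
  generalize (genY ^ 2) ^ b = B at *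
  generalize (genY ^ 2) ^ b' = B' at *
  generalize ((genX * genY) ^ 2) ^ c = C at *
  generalize ((genX * genY) ^ 2) ^ c' = C' at *
  calc A * B * C * (A' * B' * C') = A * B * (C * A') * B' * C' := by simp only [mul_assoc]
    _ = A * (B * A') * (C * B') * C' := by rw [h₁]; simp only [mul_assoc]
    _ = A * A' * (B * B') * (C * C') := by rw [h₂, h₃]; simp only [mul_assoc]

theorem genX_mul_latticeElt (a b c : ℤ) :
    genX * latticeElt a b c = latticeElt a (-b) (-c) * genX := by
  have h₁ : SemiconjBy genX ((genX ^ 2) ^ a) ((genX ^ 2) ^ a) :=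
    ((Commute.refl genX).pow_right 2).zpow_right a
  have h₂ := genX_semiconj_sq.zpow_right b
  have h₃ := genX_semiconj_mul_sq.zpow_right c
  rw [inv_zpow'] at h₂ h₃
  exact ((h₁.mul_right h₂).mul_right h₃).eq

theorem genY_mul_latticeElt (a b c : ℤ) :
    genY * latticeElt a b c = latticeElt (-a) b (-c) * genY := by
  have h₁ := genY_semiconj_sq.zpow_right a
  have h₂ : SemiconjBy genY ((genY ^ 2) ^ b) ((genY ^ 2) ^ b) :=
    ((Commute.refl genY).pow_right 2).zpow_right b
  have h₃ := genY_semiconj_mul_sq.zpow_right c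
  rw [inv_zpow'] at h₁ h₃
  exact ((h₁.mul_right h₂).mul_right h₃).eq

theorem genX_mul_genX : genX * genX = latticeElt 1 0 0 := by simp [latticeElt, sq]

theorem genY_mul_genY : genY * genY = latticeElt 0 1 0 := by simp [latticeElt, sq]

theorem latticeElt_zero : latticeElt 0 0 0 = 1 := by simp [latticeElt]

theorem genY_mul_genX_mul_genY : genY * (genX * genY) = latticeElt (-1) 0 (-1) * genX := by
  have h := genY_mul_genX_sq
  have h₁ : latticeElt (-1) 0 (-1) = latticeElt 0 0 (-1) * latticeElt (-1) 0 0 := by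
    rw [latticeElt_mul]; simp
  have h₂ : latticeElt 0 0 (-1) = (genY * genX) ^ 2 := by simp [latticeElt, h]
  have h₃ : latticeElt (-1) 0 0 = (genX ^ 2)⁻¹ := by simp [latticeElt]
  rw [h₁, h₂, h₃, sq (genY * genX), sq genX]
  group

theorem genY_mul_genX : genY * genX = latticeElt (-1) 1 (-1) * (genX * genY) := by
  have h : genY * genX * genY * genY = latticeElt (-1) 0 (-1) * genX * genY := by
    rw [← genY_mul_genX_mul_genY]; simp only [mul_assoc]
  have h' : latticeElt (-1) 1 (-1) * (genX * genY) * latticeElt 0 1 0 =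
      latticeElt (-1) 0 (-1) * genX * genY := by
    rw [mul_assoc, mul_assoc genX, genY_mul_latticeElt, ← mul_assoc genX, genX_mul_latticeElt,
      mul_assoc (latticeElt _ _ _) genX, ← mul_assoc (latticeElt _ _ _), latticeElt_mul]
    simp [mul_assoc]
  rw [← mul_left_inj (latticeElt 0 1 0), h', ← genY_mul_genY, ← h]
  simp only [mul_assoc]

/-- The translation lattice has coset representatives `1`, `x`, `y`, `xy`. -/
theorem exists_latticeElt_mul (p : PromislowGroup) : ∃ a b c : ℤ,
    p = latticeElt a b c ∨ p = latticeElt a b c * genX ∨ p = latticeElt a b c * genY ∨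
      p = latticeElt a b c * (genX * genY) := by
  set N : PromislowGroup → Prop := fun p ↦ ∃ a b c : ℤ,
    p = latticeElt a b c ∨ p = latticeElt a b c * genX ∨ p = latticeElt a b c * genY ∨
      p = latticeElt a b c * (genX * genY) with hN
  have hl (a b c : ℤ) {p} : N p → N (latticeElt a b c * p) := by
    rintro ⟨a', b', c', h⟩
    refine ⟨a + a', b + b', c + c', ?_⟩
    rw [← latticeElt_mul]
    rcases h with rfl | rfl | rfl | rfl <;> simp only [mul_assoc, true_or, or_true]
  have h1 : N 1 := ⟨0, 0, 0, .inl latticeElt_zero.symm⟩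
  have h2 : N genX := ⟨0, 0, 0, .inr (.inl (by simp [latticeElt_zero]))⟩
  have h3 : N genY := ⟨0, 0, 0, .inr (.inr (.inl (by simp [latticeElt_zero])))⟩
  have h4 : N (genX * genY) := ⟨0, 0, 0, .inr (.inr (.inr (by simp [latticeElt_zero])))⟩
  have hX {p} : N p → N (genX * p) := by
    rintro ⟨a, b, c, rfl | rfl | rfl | rfl⟩
    · rw [genX_mul_latticeElt]; exact hl _ _ _ h2
    · rw [← mul_assoc, genX_mul_latticeElt, mul_assoc, genX_mul_genX]
      exact hl _ _ _ ⟨_, _, _, .inl rfl⟩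
    · rw [← mul_assoc, genX_mul_latticeElt, mul_assoc]; exact hl _ _ _ h4
    · rw [← mul_assoc, genX_mul_latticeElt, mul_assoc, ← mul_assoc genX, genX_mul_genX]
      exact hl _ _ _ (hl _ _ _ h3)
  have hY {p} : N p → N (genY * p) := by
    rintro ⟨a, b, c, rfl | rfl | rfl | rfl⟩
    · rw [genY_mul_latticeElt]; exact hl _ _ _ h3
    · rw [← mul_assoc, genY_mul_latticeElt, mul_assoc, genY_mul_genX]
      exact hl _ _ _ (hl _ _ _ h4)
    · rw [← mul_assoc, genY_mul_latticeElt, mul_assoc, genY_mul_genY]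
      exact hl _ _ _ ⟨_, _, _, .inl rfl⟩
    · rw [← mul_assoc, genY_mul_latticeElt, mul_assoc, genY_mul_genX_mul_genY]
      exact hl _ _ _ (hl _ _ _ h2)
  have hp : p ∈ Subgroup.closure {genX, genY} := closure_gens ▸ Subgroup.mem_top p
  change N p
  induction hp using Subgroup.closure_induction_left with
  | one => exact h1
  | mul_left g hg q _ ih =>
    rcases hg with rfl | rfl
    exacts [hX ih, hY ih]
  | inv_mul_cancel g hg q _ ih =>
    -- `g⁻¹ = g⁻² g`, and `g⁻²` is in the lattice
    rcases hg with rfl | rfl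
    · have : genX⁻¹ * q = latticeElt (-1) 0 0 * (genX * q) := by simp [latticeElt, sq, mul_assoc]
      exact this ▸ hl _ _ _ (hX ih)
    · have : genY⁻¹ * q = latticeElt 0 (-1) 0 * (genY * q) := by simp [latticeElt, sq, mul_assoc]
      exact this ▸ hl _ _ _ (hY ih)

/-- A family of homomorphisms is jointly injective on Promislow's group as soon as it contains,
for each of the three rank one sublattices `⟨x²⟩`, `⟨y²⟩`, `⟨(xy)²⟩`, a member that kills the other
two and is of infinite order on this one: these three members behave like the actions of the group
on the three coordinate axes of `ℝ³`. -/
theorem eq_one_of_map_eq_one {Γ₁ Γ₂ Γ₃ : Type*} [Group Γ₁] [Group Γ₂] [Group Γ₃]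
    (f₁ : PromislowGroup →* Γ₁) (f₂ : PromislowGroup →* Γ₂) (f₃ : PromislowGroup →* Γ₃)
    (hy₁ : f₁ genY ^ 2 = 1) (hz₁ : (f₁ genX * f₁ genY) ^ 2 = 1)
    (hx₁ : ∀ n : ℤ, f₁ genX ^ n = 1 → n = 0)
    (hx₂ : f₂ genX ^ 2 = 1) (hz₂ : (f₂ genX * f₂ genY) ^ 2 = 1)
    (hy₂ : ∀ n : ℤ, f₂ genY ^ n = 1 → n = 0)
    (hx₃ : f₃ genX ^ 2 = 1) (hy₃ : f₃ genY ^ 2 = 1)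
    (hz₃ : ∀ n : ℤ, (f₃ genX * f₃ genY) ^ n = 1 → n = 0)
    {p : PromislowGroup} (h₁ : f₁ p = 1) (h₂ : f₂ p = 1) (h₃ : f₃ p = 1) : p = 1 := by
  have e₁ (a b c : ℤ) : f₁ (latticeElt a b c) = f₁ genX ^ (2 * a) := by
    simp [latticeElt, hy₁, hz₁, zpow_mul, zpow_ofNat]
  have e₂ (a b c : ℤ) : f₂ (latticeElt a b c) = f₂ genY ^ (2 * b) := by
    simp [latticeElt, hx₂, hz₂, zpow_mul, zpow_ofNat]
  have e₃ (a b c : ℤ) : f₃ (latticeElt a b c) = (f₃ genX * f₃ genY) ^ (2 * c) := by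
    simp [latticeElt, hx₃, hy₃, zpow_mul, zpow_ofNat]
  -- a reflection is not a power of the translation `f₁ x`, as it does not commute with it
  have key : ¬ Commute (f₁ genX) (f₁ genY) := fun h ↦ by
    rw [h.mul_pow, hy₁, mul_one] at hz₁
    exact absurd (hx₁ 2 (by exact_mod_cast hz₁)) (by norm_num)
  obtain ⟨a, b, c, rfl | rfl | rfl | rfl⟩ := exists_latticeElt_mul p
  · rw [e₁] at h₁
    rw [e₂] at h₂
    rw [e₃] at h₃
    have ha := hx₁ _ h₁
    have hb := hy₂ _ h₂
    have hc := hz₃ _ h₃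
    obtain ⟨rfl, rfl, rfl⟩ : a = 0 ∧ b = 0 ∧ c = 0 := by omega
    exact latticeElt_zero
  · rw [map_mul, e₁, ← zpow_add_one] at h₁
    have := hx₁ _ h₁
    omega
  · rw [map_mul, e₁] at h₁
    rw [← inv_eq_of_mul_eq_one_right h₁] at key
    exact absurd ((Commute.refl _).zpow_right _).inv_right key
  · rw [map_mul, map_mul, e₁, ← mul_assoc, ← zpow_add_one] at h₁
    rw [← inv_eq_of_mul_eq_one_right h₁] at key
    exact absurd ((Commute.refl _).zpow_right _).inv_right key

/-! ### Failure of the unique product property -/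

/-- Promislow's fourteen words, in two elements of an arbitrary group. -/
def words {Γ : Type*} [Group Γ] (x y : Γ) : List Γ :=
  let t (a b c : ℤ) : Γ := (x ^ 2) ^ a * (y ^ 2) ^ b * ((x * y) ^ 2) ^ c
  [t 0 (-1) 0 * x, t (-1) (-1) (-1) * x, t 0 0 0 * x, t (-1) 0 (-1) * x, t 0 0 (-1) * x,
    t (-1) 0 0 * x, t 0 (-1) 0 * y, t (-1) 0 0 * y, t (-1) (-1) (-1) * y, t 0 0 0 * y,
    t (-1) 0 1 * y, t (-1) (-1) 0 * y, t 0 0 1, t 0 0 (-1)]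

theorem map_words {Γ Δ : Type*} [Group Γ] [Group Δ] (f : Γ →* Δ) (x y : Γ) :
    (words x y).map f = words (f x) (f y) := by
  simp [words]

open DihedralGroup in
/-- The images of the generators in `D∞³`: the action on the three coordinate axes of `ℝ³`. -/
def axes : PromislowGroup →* DihedralGroup 0 × DihedralGroup 0 × DihedralGroup 0 :=
  lift (r 1, sr 0, sr 0) (sr 0, r 1, sr 1) (by decide) (by decide)

theorem axes_injective : Function.Injective axes := by
  rw [injective_iff_map_eq_one]
  intro p hp
  have hx : axes genX = (.r 1, .sr 0, .sr 0) := lift_genX _ _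
  have hy : axes genY = (.sr 0, .r 1, .sr 1) := lift_genY _ _
  have h (n : ℤ) : (DihedralGroup.r 1 : DihedralGroup 0) ^ n = 1 → n = 0 := by
    rw [DihedralGroup.r_zpow, DihedralGroup.one_def, DihedralGroup.r.injEq, one_mul]
    exact id
  refine eq_one_of_map_eq_one ((MonoidHom.fst _ _).comp axes)
    (((MonoidHom.fst _ _).comp (MonoidHom.snd _ _)).comp axes)
    (((MonoidHom.snd _ _).comp (MonoidHom.snd _ _)).comp axes)
    ?_ ?_ ?_ ?_ ?_ ?_ ?_ ?_ ?_ ?_ ?_ ?_ <;> simp [hx, hy, hp, sq, -DihedralGroup.r_zpow] <;>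
    exact h

open DihedralGroup in
/-- Every product of two of the words is attained a second time. -/
theorem words_axes_not_unique :
    ∀ u ∈ words (axes genX) (axes genY), ∀ v ∈ words (axes genX) (axes genY),
      ∃ u' ∈ words (axes genX) (axes genY), ∃ v' ∈ words (axes genX) (axes genY),
        u' * v' = u * v ∧ u' ≠ u := by
  have hx : axes genX = (r 1, sr 0, sr 0) := lift_genX _ _
  have hy : axes genY = (sr 0, r 1, sr 1) := lift_genY _ _
  rw [hx, hy]
  decide +kernel

theorem not_uniqueProds : ¬ UniqueProds PromislowGroup := by
  classical
  intro h
  obtain ⟨u, hu, v, hv, huv⟩ := h.uniqueMul_of_nonempty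
    (A := (words genX genY).toFinset) (B := (words genX genY).toFinset)
    ⟨_, List.mem_toFinset.2 List.mem_cons_self⟩ ⟨_, List.mem_toFinset.2 List.mem_cons_self⟩
  have hw := words_axes_not_unique
  simp only [← map_words, List.forall_mem_map] at hw
  obtain ⟨_, hu₁, _, hv₁, he, hne⟩ := hw u (List.mem_toFinset.1 hu) v (List.mem_toFinset.1 hv)
  obtain ⟨u', hu', rfl⟩ := List.mem_map.1 hu₁
  obtain ⟨v', hv', rfl⟩ := List.mem_map.1 hv₁
  rw [← map_mul, ← map_mul] at he
  exact hne (congrArg axes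
    (huv (List.mem_toFinset.2 hu') (List.mem_toFinset.2 hv') (axes_injective he)).1)

end PromislowGroup

/-- An extremal element of the product set `A B` is a unique product. -/
theorem Diffuse.uniqueProds {G : Type*} [Group G] (h : Diffuse G) : UniqueProds G where
  uniqueMul_of_nonempty {A B} hA hB := by
    classical
    obtain ⟨_, hc, hex⟩ := h (Finset.image₂ (· * ·) A B) (hA.image₂ hB)
    obtain ⟨a, ha, b, hb, rfl⟩ := Finset.mem_image₂.1 hc
    refine ⟨a, ha, b, hb, fun a' b' ha' hb' he ↦ ?_⟩
    by_cases haa : a' = a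
    · subst haa
      exact ⟨rfl, mul_left_cancel he⟩
    · -- `g = a' a⁻¹` moves the extremal element `ab` to `a'b`, and `g⁻¹` moves it to `ab'`
      refine absurd (hex (a' * a⁻¹) (by simpa [mul_inv_eq_one] using haa)) (not_or.2 ?_)
      simp only [not_not]
      constructor
      · simpa using Finset.mem_image₂_of_mem (f := (· * ·)) ha' hb
      · have : (a' * a⁻¹)⁻¹ * (a * b) = a * b' := by rw [← he]; group
        simpa only [this] using Finset.mem_image₂_of_mem (f := (· * ·)) ha hb'

/-! ### Isometries of the integers -/

/-- The sign `(-1)^s`. -/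
def sgn (s : ZMod 2) : ℤ := if s = 0 then 1 else -1

@[simp] theorem sgn_zero : sgn 0 = 1 := rfl

@[simp] theorem sgn_one : sgn 1 = -1 := rfl

theorem sgn_add (s t : ZMod 2) : sgn (s + t) = sgn s * sgn t := by decide +revert

theorem sgn_mul_self (s : ZMod 2) : sgn s * sgn s = 1 := by decide +revert

@[simp] theorem cast_sgn (s : ZMod 2) : ((sgn s : ℤ) : ZMod 2) = 1 := by decide +revert

theorem zmod_two_eq_zero_or_one (s : ZMod 2) : s = 0 ∨ s = 1 := by decide +revert

/-- The isometry `r ↦ (-1)^s r + τ` of `ℤ`. -/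
def isom (s : ZMod 2) (τ : ℤ) : Equiv.Perm ℤ where
  toFun r := sgn s * r + τ
  invFun r := sgn s * (r - τ)
  left_inv r := by simp [← mul_assoc, sgn_mul_self]
  right_inv r := by simp [← mul_assoc, sgn_mul_self]

theorem isom_apply (s : ZMod 2) (τ r : ℤ) : isom s τ r = sgn s * r + τ := rfl

theorem isom_mul (s s' : ZMod 2) (τ τ' : ℤ) :
    isom s τ * isom s' τ' = isom (s + s') (sgn s * τ' + τ) := by
  ext r
  simp only [Equiv.Perm.mul_apply, isom_apply, sgn_add]
  ring

@[simp] theorem isom_zero_zero : isom 0 0 = 1 := by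
  ext r
  simp [isom_apply]

theorem isom_inv (s : ZMod 2) (τ : ℤ) : (isom s τ)⁻¹ = isom s (-(sgn s * τ)) := by
  rw [inv_eq_iff_mul_eq_one, isom_mul, CharTwo.add_self_eq_zero, mul_neg, ← mul_assoc,
    sgn_mul_self, one_mul, neg_add_cancel, isom_zero_zero]

theorem isom_one_sq (τ : ℤ) : isom 1 τ ^ 2 = 1 := by
  rw [sq, isom_mul, CharTwo.add_self_eq_zero]
  simp

theorem isom_zero_zpow (τ n : ℤ) : isom 0 τ ^ n = isom 0 (n * τ) := by
  induction n with
  | zero => simp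
  | succ n ih =>
    rw [zpow_add_one, ih, isom_mul, add_zero, sgn_zero]
    congr 1
    ring
  | pred n ih =>
    rw [zpow_sub_one, ih, isom_inv, isom_mul, add_zero, sgn_zero]
    congr 1
    ring

theorem eq_zero_of_isom_zero_zpow_eq_one {τ : ℤ} (hτ : τ ≠ 0) {n : ℤ} (h : isom 0 τ ^ n = 1) :
    n = 0 := by
  rw [isom_zero_zpow] at h
  simpa [hτ, isom_apply] using congr($h 0)

theorem ne_zero_of_cast_eq_one {τ : ℤ} (h : (τ : ZMod 2) = 1) : τ ≠ 0 := by
  rintro rfl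
  simp at h

/-- Reflections have trivial square and invert translations, so the relation of
Promislow's group holds whenever one isometry is a reflection. -/
theorem isom_relation {s s' : ZMod 2} {θ θ' : ℤ} (h : s = 0 → s' = 0 → θ = 0 ∧ θ' = 0) :
    (isom s θ)⁻¹ * isom s' θ' ^ 2 * isom s θ * isom s' θ' ^ 2 = 1 := by
  obtain rfl | rfl := zmod_two_eq_zero_or_one s'
  · obtain rfl | rfl := zmod_two_eq_zero_or_one s
    · simp [h]
    · simp [isom_inv, isom_mul, sq, CharTwo.add_self_eq_zero]
  · simp [isom_one_sq]

/-- Two isometries whose translation parts are representatives `0` or `1` of classes modulo `2`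
coincide when their signs and these classes do. -/
theorem exists_isom_mul_inv (s s' a a' : ZMod 2) : ∃ θ : ℤ,
    isom s a.val * (isom s' a'.val)⁻¹ = isom (s + s') θ ∧ (θ : ZMod 2) = a + a' ∧
      (s + s' = 0 → a + a' = 0 → θ = 0) := by
  rw [isom_inv, isom_mul]
  refine ⟨_, rfl, ?_, ?_⟩
  · simp [CharTwo.neg_eq, add_comm]
  · intro h₁ h₂
    rw [CharTwo.add_eq_zero] at h₁ h₂
    subst h₁ h₂
    rw [mul_neg, ← mul_assoc, sgn_mul_self, one_mul, neg_add_cancel]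

/-! ### Periodic sequences over the field with four elements -/

/-- The group of periodic sequences `ℤ → 𝔽₄`. The additive group of `𝔽₄` is encoded as
`ZMod 2 × ZMod 2`; multiplication by a primitive cube root of unity is encoded in `omega`. -/
def PeriodicSeq : AddSubgroup (ℤ → ZMod 2 × ZMod 2) where
  carrier := {c | ∃ n : ℕ, 0 < n ∧ Function.Periodic c n}
  zero_mem' := ⟨1, one_pos, fun _ ↦ rfl⟩
  add_mem' := by
    rintro c d ⟨n, hn, hc⟩ ⟨m, hm, hd⟩
    refine ⟨n * m, Nat.mul_pos hn hm, ?_⟩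
    have h₁ := hc.nat_mul m
    have h₂ := hd.nat_mul n
    push_cast
    rw [mul_comm] at h₁
    exact h₁.add h₂
  neg_mem' := by
    rintro c ⟨n, hn, hc⟩
    exact ⟨n, hn, fun i ↦ congrArg Neg.neg (hc i)⟩

namespace PeriodicSeq

/-- Multiplication by the primitive cube root of unity `ω`, which is `(a, b) ↦ (b, a + b)` on
`𝔽₄`. -/
def omega : PeriodicSeq →+ PeriodicSeq where
  toFun c := ⟨fun i ↦ ((c.1 i).2, (c.1 i).1 + (c.1 i).2), by
    obtain ⟨n, hn, hc⟩ := c.2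
    exact ⟨n, hn, fun i ↦ by simp only [hc i]⟩⟩
  map_zero' := by ext <;> simp
  map_add' c d := by
    ext
    · simp
    · simp only [AddSubgroup.coe_add, Pi.add_apply, Prod.fst_add, Prod.snd_add]
      abel

/-- The relation `ω² = 1 + ω` of `𝔽₄`. -/
theorem omega_omega (c : PeriodicSeq) : omega (omega c) = c + omega c := by
  ext <;> simp [omega]

/-- The shift by `e` of a periodic sequence. -/
def shift (e : ℤ) : PeriodicSeq →+ PeriodicSeq where
  toFun c := ⟨fun i ↦ c.1 (i + e), by
    obtain ⟨n, hn, hc⟩ := c.2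
    exact ⟨n, hn, fun i ↦ (congrArg c.1 (add_right_comm i n e)).trans (hc (i + e))⟩⟩
  map_zero' := rfl
  map_add' _ _ := rfl

@[simp] theorem shift_zero (c : PeriodicSeq) : shift 0 c = c := by
  ext <;> simp [shift]

@[simp] theorem shift_shift (e f : ℤ) (c : PeriodicSeq) : shift e (shift f c) = shift (e + f) c := by
  ext <;> simp [shift, add_assoc]

theorem shift_omega (e : ℤ) (c : PeriodicSeq) : shift e (omega c) = omega (shift e c) := rfl

theorem finite_range_shift (c : PeriodicSeq) : (Set.range fun e ↦ shift e c).Finite := by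
  obtain ⟨n, hn, hc⟩ := c.2
  refine ((Set.finite_Ico (0 : ℤ) n).image fun e ↦ shift e c).subset ?_
  rintro _ ⟨e, rfl⟩
  refine ⟨e % n, ⟨Int.emod_nonneg _ (by omega), Int.emod_lt_of_pos _ (by omega)⟩, ?_⟩
  refine Subtype.ext (funext fun i ↦ ?_)
  have := (hc.int_mul (e / n)) (i + e % n)
  rw [add_assoc, Int.cast_id, mul_comm, Int.emod_add_mul_ediv] at this
  exact this.symm

/-- The periodic sequence which is `1` on the multiples of `k + 1` and `0` elsewhere. -/
def comb (k : ℕ) : PeriodicSeq :=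
  ⟨fun i ↦ if ((k + 1 : ℕ) : ℤ) ∣ i then (1, 0) else 0, k + 1, k.succ_pos, fun i ↦ by simp⟩

theorem comb_zero (k : ℕ) : (comb k).1 0 = (1, 0) := by simp [comb]

theorem comb_apply_of_natAbs_le {k : ℕ} {i : ℤ} (h0 : i ≠ 0) (h : i.natAbs ≤ k) :
    (comb k).1 i = 0 := by
  refine if_neg fun hd ↦ ?_
  have := Int.natAbs_le_of_dvd_ne_zero hd h0
  rw [Int.natAbs_natCast] at this
  omega

theorem eq_zero_of_shift_eq {e : ℤ} (h : ∀ c, shift e c = c) : e = 0 := by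
  by_contra he
  have h₁ : (comb e.natAbs).1 (0 + e) = (comb e.natAbs).1 0 :=
    congr(($(h (comb e.natAbs)) : ℤ → ZMod 2 × ZMod 2) 0)
  rw [zero_add, comb_zero, comb_apply_of_natAbs_le he le_rfl] at h₁
  exact absurd h₁ (by decide)

/-- A nonzero functional takes the values `1`, `0` on some pair `c`, `ω c`. -/
theorem exists_eq_one_and_eq_zero {μ : PeriodicSeq →+ ZMod 2} (h : μ ≠ 0) :
    ∃ c, μ c = 1 ∧ μ (omega c) = 0 := by
  obtain ⟨c, hc⟩ : ∃ c, μ c ≠ 0 := by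
    by_contra! h'
    exact h (AddMonoidHom.ext h')
  have h1 : μ c = 1 := (zmod_two_eq_zero_or_one _).resolve_left hc
  obtain h2 | h2 := zmod_two_eq_zero_or_one (μ (omega c))
  · exact ⟨c, h1, h2⟩
  · exact ⟨omega c, h2, by rw [omega_omega, map_add, h1, h2, CharTwo.add_self_eq_zero]⟩

end PeriodicSeq

open PeriodicSeq

/-! ### Embedding Promislow's group in a product of isometry groups -/

section Embedding

variable {μ : PeriodicSeq →+ ZMod 2} {u v : PeriodicSeq → Equiv.Perm ℤ}

/-- A pair `u`, `v` of families of isometries satisfies the relations of Promislow's group when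
the signs of `u`, `v` are `μ`, `μ ∘ ω` and both members are trivial wherever both signs are. -/
theorem promislow_relations
    (hu : ∀ c, ∃ θ : ℤ, u c = isom (μ c) θ ∧ (θ : ZMod 2) = μ (omega c) ∧
      (μ c = 0 → μ (omega c) = 0 → θ = 0))
    (hv : ∀ c, ∃ θ : ℤ, v c = isom (μ (omega c)) θ ∧ (θ : ZMod 2) = μ (omega (omega c)) ∧
      (μ c = 0 → μ (omega c) = 0 → θ = 0)) :
    u⁻¹ * v ^ 2 * u * v ^ 2 = 1 ∧ v⁻¹ * u ^ 2 * v * u ^ 2 = 1 := by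
  constructor <;> funext c <;> obtain ⟨θ, hθ, -, h0⟩ := hu c <;>
    obtain ⟨θ', hθ', -, h0'⟩ := hv c <;>
    simp only [Pi.mul_apply, Pi.inv_apply, Pi.pow_apply, hθ, hθ', Pi.one_apply]
  · exact isom_relation fun h₁ h₂ ↦ ⟨h0 h₁ h₂, h0' h₁ h₂⟩
  · exact isom_relation fun h₁ h₂ ↦ ⟨h0' h₂ h₁, h0 h₂ h₁⟩

/-- The resulting homomorphism is injective: if `μ c = 1` and `μ (ω c) = 0`, then `ω c`, `c`,
`ω² c` are coordinates on which `u`, `v`, `u v` respectively is the only translation among the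
three, and it is a translation by an odd integer. -/
theorem promislow_lift_injective (hμ : μ ≠ 0)
    (hu : ∀ c, ∃ θ : ℤ, u c = isom (μ c) θ ∧ (θ : ZMod 2) = μ (omega c) ∧
      (μ c = 0 → μ (omega c) = 0 → θ = 0))
    (hv : ∀ c, ∃ θ : ℤ, v c = isom (μ (omega c)) θ ∧ (θ : ZMod 2) = μ (omega (omega c)) ∧
      (μ c = 0 → μ (omega c) = 0 → θ = 0))
    (h₁ : u⁻¹ * v ^ 2 * u * v ^ 2 = 1) (h₂ : v⁻¹ * u ^ 2 * v * u ^ 2 = 1) :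
    Function.Injective (PromislowGroup.lift u v h₁ h₂) := by
  rw [injective_iff_map_eq_one]
  intro p hp
  obtain ⟨c, hc, hc'⟩ := exists_eq_one_and_eq_zero hμ
  set d := omega c with hd
  have hd' : μ (omega d) = 1 := by rw [hd, omega_omega, map_add, hc, ← hd, hc', add_zero]
  have hd₁ : μ (omega (omega d)) = 1 := by rw [omega_omega, map_add, hc', hd', zero_add]
  have hd₀ : μ (omega (omega (omega d))) = 0 := by
    rw [omega_omega, map_add, hd', hd₁, CharTwo.add_self_eq_zero]
  let ev (x : PeriodicSeq) : PromislowGroup →* Equiv.Perm ℤ :=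
    (Pi.evalMonoidHom (fun _ ↦ Equiv.Perm ℤ) x).comp (PromislowGroup.lift u v h₁ h₂)
  have evX (x) : ev x PromislowGroup.genX = u x := by simp [ev]
  have evY (x) : ev x PromislowGroup.genY = v x := by simp [ev]
  have hev (x) : ev x p = 1 := by simp [ev, hp]
  obtain ⟨θ₁, e₁, o₁, -⟩ := hu d
  obtain ⟨θ₁', e₁', -, -⟩ := hv d
  obtain ⟨θ₂, e₂, -, -⟩ := hu c
  obtain ⟨θ₂', e₂', o₂', -⟩ := hv c
  obtain ⟨θ₃, e₃, o₃, -⟩ := hu (omega d)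
  obtain ⟨θ₃', e₃', o₃', -⟩ := hv (omega d)
  rw [hc'] at e₁
  rw [hd'] at o₁ e₁'
  rw [hc] at e₂
  rw [← hd, hc'] at e₂'
  rw [← hd, hd'] at o₂'
  rw [hd'] at e₃
  rw [hd₁] at o₃ e₃'
  rw [hd₀] at o₃'
  refine PromislowGroup.eq_one_of_map_eq_one (ev d) (ev c) (ev (omega d)) ?_ ?_ ?_ ?_ ?_ ?_ ?_ ?_ ?_
    (hev _) (hev _) (hev _)
  all_goals simp only [evX, evY, e₁, e₁', e₂, e₂', e₃, e₃', isom_mul, zero_add, add_zero,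
    isom_one_sq, CharTwo.add_self_eq_zero]
  · exact fun n ↦ eq_zero_of_isom_zero_zpow_eq_one (ne_zero_of_cast_eq_one o₁)
  · exact fun n ↦ eq_zero_of_isom_zero_zpow_eq_one (ne_zero_of_cast_eq_one o₂')
  · exact fun n ↦ eq_zero_of_isom_zero_zpow_eq_one
      (ne_zero_of_cast_eq_one (by simp [o₃, o₃']))

end Embedding

/-! ### A torsion-free group of infinite-dimensional Hantzsche–Wendt type -/

/-- A disjoint union of copies of `ℤ`, indexed by the periodic sequences over `𝔽₄`. -/
abbrev Lines : Type := Σ _ : PeriodicSeq, ℤ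

/-- The permutation `g` moves the line of `c` to the line of `shift e c` by the isometry
`r ↦ (-1)^(μ c) r + τ c`, whose sign is given by a functional `μ` and whose translation part has
the parity `μ (ω c)`. The twist by `ω` is what rules out torsion. -/
def IsTwisted (g : Equiv.Perm Lines) (e : ℤ) (μ : PeriodicSeq →+ ZMod 2) (τ : PeriodicSeq → ℤ) :
    Prop :=
  (∀ c r, g ⟨c, r⟩ = ⟨shift e c, isom (μ c) (τ c) r⟩) ∧ ∀ c, (τ c : ZMod 2) = μ (omega c)

/-- The group of all permutations of the lines that satisfy `IsTwisted` for some data. -/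
def twistedGroup : Subgroup (Equiv.Perm Lines) where
  carrier := {g | ∃ e μ τ, IsTwisted g e μ τ}
  one_mem' := ⟨0, 0, 0, by simp [IsTwisted]⟩
  mul_mem' := by
    rintro g g' ⟨e, μ, τ, h, hp⟩ ⟨e', μ', τ', h', hp'⟩
    refine ⟨e + e', μ.comp (shift e') + μ',
      fun c ↦ sgn (μ (shift e' c)) * τ' c + τ (shift e' c), fun c r ↦ ?_, fun c ↦ ?_⟩
    · simp only [Equiv.Perm.mul_apply, h', h, shift_shift, AddMonoidHom.add_apply,
        AddMonoidHom.comp_apply, ← isom_mul]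
    · simp [hp, hp', shift_omega, add_comm]
  inv_mem' := by
    rintro g ⟨e, μ, τ, h, hp⟩
    refine ⟨-e, μ.comp (shift (-e)),
      fun c ↦ -(sgn (μ (shift (-e) c)) * τ (shift (-e) c)), fun c r ↦ ?_, fun c ↦ ?_⟩
    · rw [Equiv.Perm.inv_eq_iff_eq, h, AddMonoidHom.comp_apply, ← isom_inv]
      simp
    · simp [hp, shift_omega, CharTwo.neg_eq]

theorem IsTwisted.pow_apply_fst {g : Equiv.Perm Lines} {e μ τ} (h : IsTwisted g e μ τ) (n : ℕ)
    (c : PeriodicSeq) (r : ℤ) : ((g ^ n) ⟨c, r⟩).1 = shift (n * e) c := by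
  induction n with
  | zero => simp
  | succ n ih =>
    rw [pow_succ', Equiv.Perm.mul_apply, ← Sigma.eta ((g ^ n) ⟨c, r⟩), h.1, ih, shift_shift]
    push_cast
    rw [add_one_mul, add_comm]

theorem IsTwisted.pow_apply_of_eq_zero {g : Equiv.Perm Lines} {μ τ} (h : IsTwisted g 0 μ τ)
    {c : PeriodicSeq} (hc : μ c = 0) (n : ℕ) (r : ℤ) : (g ^ n) ⟨c, r⟩ = ⟨c, r + n * τ c⟩ := by
  induction n with
  | zero => simp
  | succ n ih =>
    rw [pow_succ', Equiv.Perm.mul_apply, ih, h.1, hc, isom_apply, shift_zero]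
    congr 1
    push_cast
    rw [sgn_zero]
    ring

/-- Torsion fixes every line; if `μ ≠ 0` it would be a translation by an odd integer on some line
with `μ c = 0` and `μ (ω c) = 1`, and if `μ = 0` it is a translation on every line. -/
theorem eq_one_of_mem_twistedGroup {g : Equiv.Perm Lines} (hg : g ∈ twistedGroup)
    (ho : IsOfFinOrder g) : g = 1 := by
  obtain ⟨n, hn, hgn⟩ := isOfFinOrder_iff_pow_eq_one.1 ho
  obtain ⟨e, μ, τ, h⟩ := hg
  have hn' : (n : ℤ) ≠ 0 := by exact_mod_cast hn.ne'
  obtain rfl : e = 0 := by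
    have : (n : ℤ) * e = 0 := eq_zero_of_shift_eq fun c ↦ by
      rw [← h.pow_apply_fst n c 0, hgn, Equiv.Perm.one_apply]
    exact (mul_eq_zero.1 this).resolve_left hn'
  have hτ {c} (hc : μ c = 0) : τ c = 0 := by
    have := h.pow_apply_of_eq_zero hc n 0
    rw [hgn, Equiv.Perm.one_apply] at this
    rw [zero_add] at this
    exact (mul_eq_zero.1 (eq_of_heq (Sigma.mk.inj this).2).symm).resolve_left hn'
  obtain rfl : μ = 0 := by
    by_contra hμ
    obtain ⟨c, hc, hc'⟩ := exists_eq_one_and_eq_zero hμ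
    have := h.2 (omega c)
    rw [hτ hc', omega_omega, map_add, hc, hc'] at this
    exact absurd this (by decide)
  ext1 ⟨c, r⟩
  rw [h.1, hτ rfl]
  simp

open Pointwise in
/-- The stabilizers of the sets `{c} × (r + mℤ)` separate the elements of a subgroup of the
twisted group, and have finite index as these sets have finite orbits. -/
theorem residuallyFinite_of_le_twistedGroup {G : Subgroup (Equiv.Perm Lines)}
    (hG : G ≤ twistedGroup) : Group.ResiduallyFinite G := by
  rw [Group.residuallyFinite_iff_exists_finiteIndex]
  intro g hg
  obtain ⟨⟨c, r⟩, hcr⟩ : ∃ p, g.1 p ≠ p := by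
    by_contra! h
    exact hg (Subtype.ext (Equiv.ext h))
  -- a modulus so large that `g • r ≡ r` would imply `g • r = r`
  set m : ℕ := ((g.1 ⟨c, r⟩).2 - r).natAbs + 1 with hm
  let D (p : Lines) : Set Lines := {q | q.1 = p.1 ∧ (m : ℤ) ∣ q.2 - p.2}
  have hD (h : G) (p : Lines) : h • D p = D (h.1 p) := by
    obtain ⟨e, μ, τ, ht, -⟩ := hG h.2
    ext q
    obtain ⟨q, rfl⟩ := h.1.surjective q
    have : h.1 q ∈ h • D p ↔ q ∈ D p := Set.smul_mem_smul_set_iff (a := h)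
    rw [this]
    obtain ⟨c₁, r₁⟩ := p
    obtain ⟨c₂, r₂⟩ := q
    simp only [D, Set.mem_ofPred_eq, ht]
    constructor
    · rintro ⟨rfl, hd⟩
      refine ⟨rfl, ?_⟩
      have := hd.mul_left (sgn (μ c₂))
      simpa [isom_apply, mul_sub] using this
    · rintro ⟨hc, hd⟩
      obtain rfl : c₂ = c₁ := by simpa using congrArg (shift (-e)) hc
      refine ⟨rfl, ?_⟩
      have := hd.mul_left (sgn (μ c₂))
      simpa [isom_apply, ← mul_sub, ← mul_assoc, sgn_mul_self] using this
  refine ⟨MulAction.stabilizer G (D ⟨c, r⟩), ⟨?_⟩, fun hs ↦ ?_⟩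
  · rw [MulAction.index_stabilizer]
    have hfin : (MulAction.orbit G (D ⟨c, r⟩)).Finite := by
      refine (((finite_range_shift c).prod (Set.finite_Ico (0 : ℤ) m)).image
        fun q ↦ D ⟨q.1, q.2⟩).subset ?_
      rintro _ ⟨h, rfl⟩
      obtain ⟨e, μ, τ, ht, -⟩ := hG h.2
      refine ⟨(shift e c, (isom (μ c) (τ c) r) % m), ⟨⟨e, rfl⟩, Int.emod_nonneg _ (by omega),
        Int.emod_lt_of_pos _ (by omega)⟩, ?_⟩
      simp only [hD, ht]
      ext q
      simp only [D, Set.mem_ofPred_eq]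
      refine and_congr_right fun _ ↦ ?_
      rw [Int.emod_def, sub_sub_eq_add_sub, add_sub_right_comm]
      exact dvd_add_left (dvd_mul_right _ _)
    exact ((Set.ncard_pos hfin).2 (MulAction.nonempty_orbit _)).ne'
  · rw [MulAction.mem_stabilizer_iff, hD] at hs
    have hmem : g.1 ⟨c, r⟩ ∈ D ⟨c, r⟩ := hs ▸ ⟨rfl, by simp⟩
    obtain ⟨h₁, h₂⟩ := hmem
    refine hcr (Sigma.ext h₁ (heq_of_eq ?_))
    have := Int.eq_zero_of_dvd_of_natAbs_lt_natAbs h₂ (by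
      rw [Int.natAbs_natCast]; exact Nat.lt_succ_self _)
    exact sub_eq_zero.1 this

/-! ### The three-generator subgroup and its finite index subgroups -/

/-- A family of permutations of `ℤ` acting line by line. -/
def linewise : (PeriodicSeq → Equiv.Perm ℤ) →* Equiv.Perm Lines :=
  Equiv.Perm.sigmaCongrRightHom _

theorem linewise_injective : Function.Injective linewise :=
  Equiv.Perm.sigmaCongrRightHom_injective

theorem linewise_apply (F : PeriodicSeq → Equiv.Perm ℤ) (c : PeriodicSeq) (r : ℤ) :
    linewise F ⟨c, r⟩ = ⟨c, F c r⟩ := rfl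

/-- The family of isometries of sign `μ c` whose translation part is `0` or `1`, according to the
parity `μ (ω c)`. -/
def canonical (μ : PeriodicSeq →+ ZMod 2) (c : PeriodicSeq) : Equiv.Perm ℤ :=
  isom (μ c) (μ (omega c)).val

theorem linewise_canonical_mem (μ : PeriodicSeq →+ ZMod 2) :
    linewise (canonical μ) ∈ twistedGroup :=
  ⟨0, μ, fun c ↦ (μ (omega c)).val, fun c r ↦ by rw [linewise_apply, shift_zero]; rfl,
    fun c ↦ by simp⟩

/-- The shift, as a permutation of the lines. -/
def shiftPerm : Equiv.Perm Lines where
  toFun p := ⟨shift 1 p.1, p.2⟩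
  invFun p := ⟨shift (-1) p.1, p.2⟩
  left_inv p := by simp
  right_inv p := by simp

theorem shiftPerm_mem : shiftPerm ∈ twistedGroup :=
  ⟨1, 0, 0, fun c r ↦ by simp [shiftPerm], fun c ↦ by simp⟩

theorem shiftPerm_pow_apply (k : ℕ) (c : PeriodicSeq) (r : ℤ) :
    (shiftPerm ^ k) ⟨c, r⟩ = ⟨shift k c, r⟩ := by
  induction k with
  | zero => simp
  | succ k ih =>
    rw [pow_succ', Equiv.Perm.mul_apply, ih]
    simp [shiftPerm, add_comm]

theorem shiftPerm_pow_conj_canonical (k : ℕ) (μ : PeriodicSeq →+ ZMod 2) :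
    shiftPerm ^ k * linewise (canonical μ) * (shiftPerm ^ k)⁻¹ =
      linewise (canonical (μ.comp (shift (-k)))) := by
  rw [mul_inv_eq_iff_eq_mul]
  ext1 ⟨c, r⟩
  simp only [Equiv.Perm.mul_apply, linewise_apply, shiftPerm_pow_apply, canonical,
    AddMonoidHom.comp_apply, shift_omega, shift_shift, neg_add_cancel, shift_zero]

theorem commutator_shiftPerm_pow (k : ℕ) (μ : PeriodicSeq →+ ZMod 2) :
    linewise (canonical μ) * shiftPerm ^ k * (linewise (canonical μ))⁻¹ * (shiftPerm ^ k)⁻¹ =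
      linewise (canonical μ * (canonical (μ.comp (shift (-k))))⁻¹) := by
  rw [map_mul, map_inv, ← shiftPerm_pow_conj_canonical]
  group

/-- The functional taking a sequence to the first coordinate of its entry at `0`. -/
def headFst : PeriodicSeq →+ ZMod 2 where
  toFun c := (c.1 0).1
  map_zero' := rfl
  map_add' _ _ := rfl

/-- The group generated by the shift and the canonical families of the functionals `headFst` and
`headFst ∘ ω`. -/
def persistentGroup : Subgroup (Equiv.Perm Lines) :=
  Subgroup.closure {linewise (canonical headFst), linewise (canonical (headFst.comp omega)),
    shiftPerm}

theorem persistentGroup_le : persistentGroup ≤ twistedGroup := by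
  rw [persistentGroup, Subgroup.closure_le]
  rintro _ (rfl | rfl | rfl)
  exacts [linewise_canonical_mem _, linewise_canonical_mem _, shiftPerm_mem]

theorem fg_persistentGroup : Group.FG persistentGroup :=
  Group.closure_finite_fg _

/-- A finite index subgroup contains a normal subgroup of finite index `k`, hence the commutators of
the two linewise generators with `t ^ k`. On the line of `c` these are quotients of two isometries
which agree wherever both signs cancel, so the commutators generate a copy of Promislow's group. -/
theorem persistentlyContains_persistentGroup :
    PersistentlyContains persistentGroup PromislowGroup := by
  intro C hC
  let x : persistentGroup := ⟨_, Subgroup.subset_closure (.inl rfl)⟩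
  let y : persistentGroup := ⟨_, Subgroup.subset_closure (.inr (.inl rfl))⟩
  let t : persistentGroup := ⟨_, Subgroup.subset_closure (.inr (.inr rfl))⟩
  set k := C.normalCore.index with hk
  have hk0 : k ≠ 0 := Subgroup.FiniteIndex.index_ne_zero
  have htk : t ^ k ∈ C.normalCore := Subgroup.pow_index_mem _ t
  have hcomm (g : persistentGroup) : g * t ^ k * g⁻¹ * (t ^ k)⁻¹ ∈ C :=
    C.normalCore_le (mul_mem (Subgroup.Normal.conj_mem inferInstance _ htk g) (inv_mem htk))
  set μ : PeriodicSeq →+ ZMod 2 := headFst + headFst.comp (shift (-k)) with hμ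
  let family (ν : PeriodicSeq →+ ZMod 2) : PeriodicSeq → Equiv.Perm ℤ :=
    canonical ν * (canonical (ν.comp (shift (-k))))⁻¹
  have hu (c) : ∃ θ : ℤ, family headFst c = isom (μ c) θ ∧ (θ : ZMod 2) = μ (omega c) ∧
      (μ c = 0 → μ (omega c) = 0 → θ = 0) := exists_isom_mul_inv _ _ _ _
  have hv (c) : ∃ θ : ℤ, family (headFst.comp omega) c = isom (μ (omega c)) θ ∧
      (θ : ZMod 2) = μ (omega (omega c)) ∧ (μ c = 0 → μ (omega c) = 0 → θ = 0) := by
    obtain ⟨θ, h₁, h₂, h₃⟩ := exists_isom_mul_inv ((headFst.comp omega) c)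
      (((headFst.comp omega).comp (shift (-k))) c) ((headFst.comp omega) (omega c))
      (((headFst.comp omega).comp (shift (-k))) (omega c))
    refine ⟨θ, h₁, h₂, fun hc hc' ↦ h₃ hc' ?_⟩
    have h₄ : μ (omega (omega c)) = 0 := by rw [omega_omega, map_add, hc, hc', add_zero]
    exact h₄
  obtain ⟨r₁, r₂⟩ := promislow_relations hu hv
  have hμ0 : μ ≠ 0 := by
    intro h
    -- `comb k` is `1` at `0` and `0` at `-k`
    have h₁ : ((comb k).1 0).1 + ((comb k).1 (0 + -k)).1 = 0 := congr($h (comb k))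
    rw [zero_add, comb_zero, comb_apply_of_natAbs_le (by simpa using hk0) (by simp)] at h₁
    exact absurd h₁ (by decide)
  let φ : PromislowGroup →* Equiv.Perm Lines := linewise.comp (PromislowGroup.lift _ _ r₁ r₂)
  have hφ : Function.Injective φ :=
    linewise_injective.comp (promislow_lift_injective hμ0 hu hv r₁ r₂)
  have hφx : φ PromislowGroup.genX = (x * t ^ k * x⁻¹ * (t ^ k)⁻¹ : persistentGroup) :=
    (congrArg linewise (PromislowGroup.lift_genX r₁ r₂)).trans (commutator_shiftPerm_pow k _).symm
  have hφy : φ PromislowGroup.genY = (y * t ^ k * y⁻¹ * (t ^ k)⁻¹ : persistentGroup) :=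
    (congrArg linewise (PromislowGroup.lift_genY r₁ r₂)).trans (commutator_shiftPerm_pow k _).symm
  have hmem (p) : φ p ∈ persistentGroup :=
    PromislowGroup.range_le φ (hφx ▸ Subtype.property _) (hφy ▸ Subtype.property _) ⟨p, rfl⟩
  let ψ : PromislowGroup →* persistentGroup := φ.codRestrict _ hmem
  have hψ : Function.Injective ψ := fun p q h ↦ hφ (congrArg Subtype.val h)
  refine ⟨ψ.range, PromislowGroup.range_le ψ ?_ ?_, ⟨(MonoidHom.ofInjective hψ).symm⟩⟩
  · have : ψ PromislowGroup.genX = x * t ^ k * x⁻¹ * (t ^ k)⁻¹ := Subtype.ext hφx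
    exact this ▸ hcomm x
  · have : ψ PromislowGroup.genY = y * t ^ k * y⁻¹ * (t ^ k)⁻¹ := Subtype.ext hφy
    exact this ▸ hcomm y

theorem PersistentlyContains.not_uniqueProds {G : Type*} [Group G]
    (h : PersistentlyContains G PromislowGroup) (C : Subgroup G) (hC : C.FiniteIndex) :
    ¬ UniqueProds C := by
  intro hu
  obtain ⟨H, hHC, ⟨e⟩⟩ := h C hC
  refine PromislowGroup.not_uniqueProds (UniqueProds.of_injective_mulHom
    ((Subgroup.inclusion hHC).comp e.symm.toMonoidHom : PromislowGroup →* C).toMulHom ?_ hu)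
  exact (Subgroup.inclusion_injective hHC).comp e.symm.injective

theorem mainTheorem1 :
    ∃ (G : Type) (_ : Group G),
      Group.FG G ∧ Group.ResiduallyFinite G ∧ GroupTorsionFree G ∧
      PersistentlyContains G PromislowGroup ∧
      (∀ C : Subgroup G, C.FiniteIndex → ¬ UniqueProds C) ∧
      ¬ VirtuallyDiffuse G := by
  have hP := persistentlyContains_persistentGroup
  refine ⟨persistentGroup, inferInstance, fg_persistentGroup,
    residuallyFinite_of_le_twistedGroup persistentGroup_le, fun g hg ↦ ?_, hP,
    hP.not_uniqueProds, ?_⟩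
  · exact Subtype.ext (eq_one_of_mem_twistedGroup (persistentGroup_le g.2)
      (Submonoid.isOfFinOrder_coe.2 hg))
  · rintro ⟨C, hC, hd⟩
    exact hP.not_uniqueProds C hC hd.uniqueProds
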